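/- Let $p\in(1,\infty)$ and $\alpha>0$, and let $T_\alpha$ be the bounded operator on the complex Banach space $L^p[0,1]$ given by $(T_\alpha f)(x)=\int_0^{x^\alpha} f(y)\,dy$. Let $\sigma(T_\alpha)$ denote its spectrum and $\sigma_0(T_\alpha)$ its point spectrum (set of eigenvalues). (1) If $\alpha\ge 1$, then $\sigma(T_\alpha)=\{0\}$ and $\sigma_0(T_\alpha)=\emptyset$. (2) If $\alpha<1$, then $\sigma(T_\alpha)=\sigma_0(T_\alpha)\cup\{0\}$ and $\sigma_0(T_\alpha)=\{\alpha^n(1-\alpha): n=0,1,2,\dots\}$. For every integer $n\ge 0$ put $$P_{n,\alpha}(y)=\sum_{k=0}^n\Big(\prod_{j=0}^{k-1}\frac{1-\alpha^{j-n}}{1-\alpha^{-1}}\Big)\frac{y^k}{k!},\qquad f_n(x)=x^{\frac{\alpha}{1-\alpha}}P_{n,\alpha}(\log x).$$ Then $P_{n,\alpha}$ is a polynomial of degree exactly $n$, the function $f_n$ belongs to $L^p[0,1]$, the eigenspace of $T_\alpha$ for the eigenvalue $\alpha^n(1-\alpha)$ is the line spanned by $f_n$, and the linear span of $\{f_n: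 n\ge 0\}$ is dense in $L^p[0,1]$. -/

import Mathlib

open MeasureTheory
open scoped ENNReal

namespace VolterraType

/-- Lebesgue measure on the interval `[0,1]`. -/
noncomputable abbrev unitMeasure : Measure ℝ := volume.restrict (Set.Icc (0 : ℝ) 1)

instance : IsProbabilityMeasure unitMeasure := ⟨by simp [unitMeasure]⟩

/-- The complex Banach space `L^p[0,1]`. -/
abbrev LpUnit (p : ℝ≥0∞) : Type := Lp ℂ p unitMeasure

/-- The function `x ↦ ∫_0^{x^α} f(y) dy`. -/
noncomputable def volterraFun (α : ℝ) (f : ℝ → ℂ) (x : ℝ) : ℂ :=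
  ∫ y in (0 : ℝ)..(x ^ α), f y

theorem rpow_mem_unit {α : ℝ} (hα : 0 < α) {x : ℝ} (hx : x ∈ Set.Icc (0 : ℝ) 1) :
    x ^ α ∈ Set.Icc (0 : ℝ) 1 :=
  ⟨Real.rpow_nonneg hx.1 α, Real.rpow_le_one hx.1 hx.2 hα.le⟩

theorem intervalIntegrable_of_mem {f : ℝ → ℂ} (hf : Integrable f unitMeasure) {z : ℝ}
    (hz : z ∈ Set.Icc (0 : ℝ) 1) : IntervalIntegrable f volume 0 z := by
  rw [intervalIntegrable_iff_integrableOn_Ioc_of_le hz.1]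
  exact IntegrableOn.mono_set (t := Set.Icc (0 : ℝ) 1) hf
    fun y hy => ⟨hy.1.le, hy.2.trans hz.2⟩

/-- Inside `[0,1]`, `volterraFun α f` depends only on the class of `f` on `[0,1]`. -/
theorem volterraFun_congr {α : ℝ} (hα : 0 < α) {f g : ℝ → ℂ} (h : f =ᵐ[unitMeasure] g)
    {x : ℝ} (hx : x ∈ Set.Icc (0 : ℝ) 1) : volterraFun α f x = volterraFun α g x := by
  have hz := rpow_mem_unit hα hx
  unfold volterraFun
  rw [intervalIntegral.integral_of_le hz.1, intervalIntegral.integral_of_le hz.1]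
  refine integral_congr_ae (ae_restrict_of_ae_restrict_of_subset (t := Set.Icc (0 : ℝ) 1)
    (fun y hy => ⟨hy.1.le, hy.2.trans hz.2⟩) h)

theorem continuousOn_volterraFun {α : ℝ} (hα : 0 < α) {f : ℝ → ℂ}
    (hf : Integrable f unitMeasure) : ContinuousOn (volterraFun α f) (Set.Icc 0 1) := by
  have h1 : ContinuousOn (fun z : ℝ => ∫ y in (0 : ℝ)..z, f y) (Set.Icc 0 1) := by
    have := intervalIntegral.continuousOn_primitive_interval (μ := volume) (f := f)
      (a := 0) (b := 1) (by rw [Set.uIcc_of_le zero_le_one]; exact hf)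
    rwa [Set.uIcc_of_le zero_le_one] at this
  exact h1.comp (Real.continuous_rpow_const hα.le).continuousOn fun x hx => rpow_mem_unit hα hx

theorem norm_volterraFun_le {α : ℝ} (hα : 0 < α) {f : ℝ → ℂ} (hf : Integrable f unitMeasure)
    {x : ℝ} (hx : x ∈ Set.Icc (0 : ℝ) 1) :
    ‖volterraFun α f x‖ ≤ ∫ y, ‖f y‖ ∂unitMeasure := by
  have hz := rpow_mem_unit hα hx
  unfold volterraFun
  rw [intervalIntegral.integral_of_le hz.1]
  refine (norm_integral_le_integral_norm _).trans ?_
  exact setIntegral_mono_set (s := Set.Ioc 0 (x ^ α)) (t := Set.Icc (0 : ℝ) 1) hf.norm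
    (Filter.Eventually.of_forall fun y => norm_nonneg _)
    (ae_of_all _ fun _ hy => ⟨hy.1.le, hy.2.trans hz.2⟩)

theorem ae_mem_unit : ∀ᵐ x ∂unitMeasure, x ∈ Set.Icc (0 : ℝ) 1 :=
  ae_restrict_mem measurableSet_Icc

theorem memLp_volterraFun (p : ℝ≥0∞) {α : ℝ} (hα : 0 < α) {f : ℝ → ℂ}
    (hf : Integrable f unitMeasure) : MemLp (volterraFun α f) p unitMeasure :=
  MemLp.of_bound ((continuousOn_volterraFun hα hf).aestronglyMeasurable measurableSet_Icc)
    (∫ y, ‖f y‖ ∂unitMeasure)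
    (ae_mem_unit.mono fun _ hx => norm_volterraFun_le hα hf hx)

variable (p : ℝ≥0∞) [hp : Fact (1 ≤ p)]

theorem integrable_coe (f : LpUnit p) : Integrable f unitMeasure :=
  (Lp.memLp f).integrable hp.out

theorem integral_norm_le (f : LpUnit p) : ∫ y, ‖f y‖ ∂unitMeasure ≤ ‖f‖ := by
  rw [integral_norm_eq_lintegral_enorm (integrable_coe p f).1, ← eLpNorm_one_eq_lintegral_enorm,
    Lp.norm_def]
  exact ENNReal.toReal_mono (Lp.eLpNorm_ne_top f)
    (eLpNorm_le_eLpNorm_of_exponent_le hp.out (integrable_coe p f).1)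

/-- The bounded operator `T_α` on `L^p[0,1]`, `(T_α f)(x) = ∫_0^{x^α} f(y) dy`. -/
noncomputable def volterraOp {α : ℝ} (hα : 0 < α) : LpUnit p →L[ℂ] LpUnit p :=
  LinearMap.mkContinuous
    { toFun := fun f => (memLp_volterraFun p hα (integrable_coe p f)).toLp (volterraFun α f)
      map_add' := fun f g => by
        rw [← MemLp.toLp_add, MemLp.toLp_eq_toLp_iff]
        refine ae_mem_unit.mono fun x hx => ?_
        rw [volterraFun_congr hα (Lp.coeFn_add f g) hx]
        exact intervalIntegral.integral_add
          (intervalIntegrable_of_mem (integrable_coe p f) (rpow_mem_unit hα hx))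
          (intervalIntegrable_of_mem (integrable_coe p g) (rpow_mem_unit hα hx))
      map_smul' := fun c f => by
        rw [RingHom.id_apply, ← MemLp.toLp_const_smul, MemLp.toLp_eq_toLp_iff]
        refine ae_mem_unit.mono fun x hx => ?_
        rw [volterraFun_congr hα (Lp.coeFn_smul c f) hx]
        exact intervalIntegral.integral_smul c f }
    1 fun f => by
      have hb : ∀ᵐ x ∂unitMeasure,
          ‖((memLp_volterraFun p hα (integrable_coe p f)).toLp (volterraFun α f)) x‖ ≤ ‖f‖ := by
        filter_upwards [ae_mem_unit,
          (memLp_volterraFun p hα (integrable_coe p f)).coeFn_toLp] with x hx hx'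
        rw [hx']
        exact (norm_volterraFun_le hα (integrable_coe p f) hx).trans (integral_norm_le p f)
      simpa [measureUnivNNReal] using Lp.norm_le_of_ae_bound (norm_nonneg f) hb

/-- Sanity check: `T_α f` is the class of `x ↦ ∫_0^{x^α} f(y) dy`. -/
theorem coeFn_volterraOp {α : ℝ} (hα : 0 < α) (f : LpUnit p) :
    volterraOp p hα f =ᵐ[unitMeasure] fun x => ∫ y in (0 : ℝ)..(x ^ α), f y :=
  (memLp_volterraFun p hα (integrable_coe p f)).coeFn_toLp

/-- The point spectrum (set of eigenvalues) of a bounded operator. -/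
def pointSpectrum {E : Type*} [NormedAddCommGroup E] [NormedSpace ℂ E] (T : E →L[ℂ] E) : Set ℂ :=
  {l : ℂ | Module.End.HasEigenvalue (T : E →ₗ[ℂ] E) l}

/-- The polynomial
`P_{n,α}(y) = ∑_{k=0}^n (∏_{j=0}^{k-1} (1 - α^{j-n}) / (1 - α^{-1})) y^k / k!`. -/
noncomputable def eigenPoly (α : ℝ) (n : ℕ) : Polynomial ℝ :=
  ∑ k ∈ Finset.range (n + 1),
    Polynomial.monomial k
      ((∏ j ∈ Finset.range k, (1 - α ^ ((j : ℤ) - (n : ℤ))) / (1 - α⁻¹)) / (k.factorial : ℝ))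

/-- The function `f_n(x) = x^{α/(1-α)} P_{n,α}(log x)`. -/
noncomputable def eigenFun (α : ℝ) (n : ℕ) (x : ℝ) : ℂ :=
  ((x ^ (α / (1 - α)) * (eigenPoly α n).eval (Real.log x) : ℝ) : ℂ)

end VolterraType

/-!
Write `(S_α f)(x) = ∫_{x^α}^1 f`, so that `T_α f = (∫₀¹ f) • 1 - S_α f` is a rank one operator minus
`S_α`. Since `x^α ≤ x` for `α ≥ 1` and `x ≤ x^α` for `α ≤ 1`, the iterates of `T_α` (if `α ≥ 1`) and of
`S_α` (if `α ≤ 1`) are dominated by those of the classical Volterra operators on `[0,x]` and `[x,1]`.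
Their powers decay like `1 / n!` (`norm_volterraOp_pow_succ_le`, `norm_complOp_pow_succ_le`), so they are
quasinilpotent. This settles `α ≥ 1`, as `T_α` is injective (`eq_zero_of_volterraOp_eq_zero`).

Let `α < 1` and `l ≠ 0`. Then `l + S_α` is invertible, and `l - T_α` is a rank one perturbation of it, so
`l` is either an eigenvalue or in the resolvent set (`mem_pointSpectrum_of_mem_spectrum`), and every
eigenvector is a multiple of `(l + S_α)⁻¹ 1`. That function is explicit. With `s = α / (1 - α)`,
`μ = (1 - α) / l` and `a_k = ∏_{j<k} (1 - μ α^j)`, the function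
`g(x) = x^s ∑ₖ a_k (-s log x)^k / k!` satisfies `(l + S_α) g = l • 1` (`pantographSol_integral_eq`). Its
limit at `0` is `A = lim a_k`, by regularity of Borel summation (`tendsto_exp_neg_mul_tsum`), and letting
`x → 0` in the equation gives `∫₀¹ g = l (1 - A)`. Hence `l` is an eigenvalue iff `A = 0`, iff some
factor `1 - μ α^n` is zero, iff `l = α^n (1 - α)`. In that case the series terminates and `g = f_n`
(`eigenFun_eq_pantographSol`).

For completeness, the `P_n` have degree exactly `n`, so the `f_n` span all `x^s (log x)^k`. Expanding
`x^{r+d} = x^r e^{d log x}` shows that a closed subspace containing `x^r (log x)^k` for all `k` also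
contains `x^{r+d} (log x)^k` for `|d| ≤ r / 4` (`classMem_powLog_add`). In finitely many steps it contains
every `x^r` with `r > 0`, then the polynomials, and then everything.
-/

namespace VolterraType

/-! ### Quasinilpotent Volterra operators and the rank one perturbation -/

/-- By spectral mapping, `‖l‖ ^ (n + 1) ≤ ‖A ^ (n + 1)‖ ≤ 1 / n!` for every `n`. -/
theorem eq_zero_of_mem_spectrum_of_norm_pow_le {E : Type*} [NormedAddCommGroup E]
    [NormedSpace ℂ E] [CompleteSpace E] [Nontrivial E] {A : E →L[ℂ] E}
    (h : ∀ n : ℕ, ‖A ^ (n + 1)‖ ≤ 1 / (n.factorial : ℝ)) {l : ℂ} (hl : l ∈ spectrum ℂ A) :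
    l = 0 := by
  by_contra hne
  have hpos : 0 < ‖l‖ := norm_pos_iff.mpr hne
  have key : ∀ n : ℕ, ‖l‖ ≤ (‖l‖⁻¹) ^ n / (n.factorial : ℝ) := fun n => by
    have h1 := (spectrum.norm_le_norm_of_mem (spectrum.pow_mem_pow A (n + 1) hl)).trans (h n)
    rw [norm_pow] at h1
    have h2 : ‖l‖ = (‖l‖⁻¹) ^ n * ‖l‖ ^ (n + 1) := by
      rw [pow_succ, ← mul_assoc, ← mul_pow, inv_mul_cancel₀ hpos.ne', one_pow, one_mul]
    calc ‖l‖ = (‖l‖⁻¹) ^ n * ‖l‖ ^ (n + 1) := h2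
      _ ≤ (‖l‖⁻¹) ^ n * (1 / (n.factorial : ℝ)) := by gcongr
      _ = _ := by ring
  exact absurd (ge_of_tendsto' (FloorSemiring.tendsto_pow_div_factorial_atTop ‖l‖⁻¹) key)
    (not_le.mpr hpos)

section
variable (p : ℝ≥0∞)

/-- The constant function `1` as an element of `L^p[0,1]`. -/
noncomputable def oneLp : LpUnit p := (memLp_const (1 : ℂ)).toLp fun _ => (1 : ℂ)

theorem coeFn_oneLp : oneLp p =ᵐ[unitMeasure] fun _ => (1 : ℂ) := MemLp.coeFn_toLp _

theorem oneLp_ne_zero : oneLp p ≠ 0 := by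
  intro h
  have h1 := coeFn_oneLp p
  rw [h] at h1
  have h2 : ∀ᵐ _x ∂unitMeasure, False := by
    filter_upwards [h1, Lp.coeFn_zero ℂ p unitMeasure] with x hx hx'
    rw [hx'] at hx
    simp at hx
  exact Filter.eventually_const.mp h2

instance : Nontrivial (LpUnit p) := ⟨⟨oneLp p, 0, oneLp_ne_zero p⟩⟩

variable [hp : Fact (1 ≤ p)]


/-- An operator `A` that maps `L^p` to `L^∞` with norm at most `1`, and functions bounded by `c w^n`
to functions bounded by `c w^(n+1) / (n+1)`, satisfies `‖A^(n+1)‖ ≤ 1 / n!`: after the first step the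
bound acquires one power of the weight `w` and one factor of the factorial at each application. -/
theorem norm_pow_succ_le_of_iterated_bound {A : LpUnit p →L[ℂ] LpUnit p} {w : ℝ → ℝ}
    (hw : ∀ x ∈ Set.Icc (0 : ℝ) 1, w x ∈ Set.Icc (0 : ℝ) 1)
    (h0 : ∀ f : LpUnit p, ∀ᵐ x ∂unitMeasure, ‖A f x‖ ≤ ‖f‖)
    (hs : ∀ (f : LpUnit p) (c : ℝ) (n : ℕ), (∀ᵐ x ∂unitMeasure, ‖f x‖ ≤ c * w x ^ n) →
      ∀ᵐ x ∂unitMeasure, ‖A f x‖ ≤ c / (n + 1) * w x ^ (n + 1)) (n : ℕ) :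
    ‖A ^ (n + 1)‖ ≤ 1 / (n.factorial : ℝ) := by
  have key : ∀ (n : ℕ) (f : LpUnit p),
      ∀ᵐ x ∂unitMeasure, ‖(A ^ (n + 1)) f x‖ ≤ ‖f‖ / (n.factorial : ℝ) * w x ^ n := by
    intro n f
    induction n with
    | zero => simpa using h0 f
    | succ n ih =>
      have := hs _ _ _ ih
      rw [pow_succ']
      filter_upwards [this] with x hx
      refine hx.trans (le_of_eq ?_)
      rw [Nat.factorial_succ]
      push_cast
      rw [div_div, mul_comm (n.factorial : ℝ)]
  refine ContinuousLinearMap.opNorm_le_bound _ (by positivity) fun f => ?_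
  have hb : ∀ᵐ x ∂unitMeasure, ‖(A ^ (n + 1)) f x‖ ≤ 1 / (n.factorial : ℝ) * ‖f‖ := by
    filter_upwards [key n f, ae_mem_unit] with x hx hx'
    refine hx.trans ?_
    have h1 : w x ^ n ≤ 1 := pow_le_one₀ (hw x hx').1 (hw x hx').2
    calc ‖f‖ / (n.factorial : ℝ) * w x ^ n ≤ ‖f‖ / (n.factorial : ℝ) * 1 := by gcongr
      _ = _ := by ring
  simpa [measureUnivNNReal] using Lp.norm_le_of_ae_bound (by positivity) hb

/-- The functional `f ↦ ∫₀¹ f` on `L^p[0,1]`. -/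
noncomputable def meanCLM : LpUnit p →L[ℂ] ℂ :=
  LinearMap.mkContinuous
    { toFun := fun f => ∫ y, f y ∂unitMeasure
      map_add' := fun f g => by
        rw [integral_congr_ae (Lp.coeFn_add f g)]
        exact integral_add (integrable_coe p f) (integrable_coe p g)
      map_smul' := fun c f => by
        rw [integral_congr_ae (Lp.coeFn_smul c f)]
        exact integral_smul c f }
    1 fun f => by
      rw [one_mul]
      exact (norm_integral_le_integral_norm _).trans (integral_norm_le p f)

theorem meanCLM_apply (f : LpUnit p) : meanCLM p f = ∫ y, f y ∂unitMeasure := rfl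

/-- The complementary operator `(S_α f)(x) = ∫_{x^α}^1 f(y) dy`, encoded as the difference of the
rank one operator `f ↦ (∫₀¹ f) • 1` and `T_α`. -/
noncomputable def complOp {α : ℝ} (hα : 0 < α) : LpUnit p →L[ℂ] LpUnit p :=
  (meanCLM p).smulRight (oneLp p) - volterraOp p hα

theorem volterraOp_apply_eq {α : ℝ} (hα : 0 < α) (f : LpUnit p) :
    volterraOp p hα f = meanCLM p f • oneLp p - complOp p hα f := by
  simp [complOp]

theorem integral_unitMeasure (f : ℝ → ℂ) :
    ∫ y, f y ∂unitMeasure = ∫ y in (0 : ℝ)..1, f y := by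
  rw [intervalIntegral.integral_of_le zero_le_one, integral_Icc_eq_integral_Ioc]

theorem integral_sub_volterraFun {α : ℝ} (hα : 0 < α) {f : ℝ → ℂ} (hf : Integrable f unitMeasure)
    {x : ℝ} (hx : x ∈ Set.Icc (0 : ℝ) 1) :
    (∫ y, f y ∂unitMeasure) - volterraFun α f x = ∫ y in (x ^ α)..1, f y := by
  rw [integral_unitMeasure, volterraFun]
  exact intervalIntegral.integral_interval_sub_left
    (intervalIntegrable_of_mem hf ⟨zero_le_one, le_rfl⟩)
    (intervalIntegrable_of_mem hf (rpow_mem_unit hα hx))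

theorem coeFn_complOp {α : ℝ} (hα : 0 < α) (f : LpUnit p) :
    complOp p hα f =ᵐ[unitMeasure] fun x => ∫ y in (x ^ α)..1, f y := by
  have h : complOp p hα f = meanCLM p f • oneLp p - volterraOp p hα f := by simp [complOp]
  rw [h]
  filter_upwards [Lp.coeFn_sub (meanCLM p f • oneLp p) (volterraOp p hα f),
    Lp.coeFn_smul (meanCLM p f) (oneLp p), coeFn_oneLp p, coeFn_volterraOp p hα f, ae_mem_unit]
    with x h1 h2 h3 h4 h5
  rw [h1, Pi.sub_apply, h2, Pi.smul_apply, h3, h4, smul_eq_mul, mul_one, meanCLM_apply]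
  exact integral_sub_volterraFun hα (integrable_coe p f) h5

theorem ae_imp_of_ae_unit {P : ℝ → Prop} (h : ∀ᵐ x ∂unitMeasure, P x) {a b : ℝ} (ha : 0 ≤ a)
    (hb : b ≤ 1) : ∀ᵐ t, t ∈ Set.Ioc a b → P t := by
  filter_upwards [(ae_restrict_iff' measurableSet_Icc).mp h] with t ht h'
  exact ht ⟨ha.trans h'.1.le, h'.2.trans hb⟩

/-- For `α ≥ 1` the iterates of `T_α` are dominated by those of the Volterra operator, since
`x^α ≤ x`; the weight is `w x = x`. -/
theorem norm_volterraOp_pow_succ_le {α : ℝ} (hα : 0 < α) (h1 : 1 ≤ α) (n : ℕ) :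
    ‖volterraOp p hα ^ (n + 1)‖ ≤ 1 / (n.factorial : ℝ) := by
  refine norm_pow_succ_le_of_iterated_bound p (w := id) (fun x hx => hx) (fun f => ?_)
    (fun f c n hf => ?_) n
  · filter_upwards [coeFn_volterraOp p hα f, ae_mem_unit] with x hx hx'
    rw [hx]
    exact (norm_volterraFun_le hα (integrable_coe p f) hx').trans (integral_norm_le p f)
  · have hc : 0 ≤ c := by
      have : ∀ᵐ x ∂unitMeasure, 0 ≤ c := by
        have h0 : ∀ᵐ x ∂unitMeasure, x ≠ 0 := ae_restrict_of_ae (by simp [ae_iff])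
        filter_upwards [hf, ae_mem_unit, h0] with x hx hx' hx0
        have hx1 : 0 < x := lt_of_le_of_ne hx'.1 (Ne.symm hx0)
        exact nonneg_of_mul_nonneg_left ((norm_nonneg _).trans hx) (pow_pos hx1 n)
      exact Filter.eventually_const.mp this
    filter_upwards [coeFn_volterraOp p hα f, ae_mem_unit] with x hx hx'
    have hz := rpow_mem_unit hα hx'
    rw [hx]
    calc ‖∫ y in (0 : ℝ)..(x ^ α), f y‖ ≤ ∫ y in (0 : ℝ)..(x ^ α), c * y ^ n :=
          intervalIntegral.norm_integral_le_of_norm_le hz.1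
            (ae_imp_of_ae_unit hf le_rfl hz.2)
            (Continuous.intervalIntegrable (by fun_prop) _ _)
      _ = c / (n + 1) * (x ^ α) ^ (n + 1) := by
          rw [intervalIntegral.integral_const_mul, integral_pow]
          simp; ring
      _ ≤ c / (n + 1) * x ^ (n + 1) := by
          have : x ^ α ≤ x := by
            simpa using Real.rpow_le_rpow_of_exponent_ge' hx'.1 hx'.2 zero_le_one h1
          gcongr
          exact hz.1

/-- For `α ≤ 1` the iterates of `S_α` are dominated by those of `f ↦ ∫_x^1 f`, since `x ≤ x^α`; the
weight is `w x = 1 - x`. -/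
theorem norm_complOp_pow_succ_le {α : ℝ} (hα : 0 < α) (h1 : α ≤ 1) (n : ℕ) :
    ‖complOp p hα ^ (n + 1)‖ ≤ 1 / (n.factorial : ℝ) := by
  refine norm_pow_succ_le_of_iterated_bound p (w := fun x => 1 - x)
    (fun x hx => ⟨by linarith [hx.2], by linarith [hx.1]⟩) (fun f => ?_)
    (fun f c n hf => ?_) n
  · filter_upwards [coeFn_complOp p hα f, ae_mem_unit] with x hx hx'
    have hz := rpow_mem_unit hα hx'
    rw [hx]
    refine le_trans ?_ (integral_norm_le p f)
    rw [intervalIntegral.integral_of_le hz.2]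
    refine (norm_integral_le_integral_norm _).trans ?_
    exact setIntegral_mono_set (s := Set.Ioc (x ^ α) 1) (t := Set.Icc (0 : ℝ) 1)
      (integrable_coe p f).norm (Filter.Eventually.of_forall fun y => norm_nonneg _)
      (ae_of_all _ fun _ hy => ⟨hz.1.trans hy.1.le, hy.2⟩)
  · have hc : 0 ≤ c := by
      have : ∀ᵐ x ∂unitMeasure, 0 ≤ c := by
        have h0 : ∀ᵐ x ∂unitMeasure, x ≠ 1 := ae_restrict_of_ae (by simp [ae_iff])
        filter_upwards [hf, ae_mem_unit, h0] with x hx hx' hx0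
        have hx1 : 0 < 1 - x := sub_pos.mpr (lt_of_le_of_ne hx'.2 hx0)
        exact nonneg_of_mul_nonneg_left ((norm_nonneg _).trans hx) (pow_pos hx1 n)
      exact Filter.eventually_const.mp this
    filter_upwards [coeFn_complOp p hα f, ae_mem_unit] with x hx hx'
    have hz := rpow_mem_unit hα hx'
    rw [hx]
    calc ‖∫ y in (x ^ α)..1, f y‖ ≤ ∫ y in (x ^ α)..1, c * (1 - y) ^ n :=
          intervalIntegral.norm_integral_le_of_norm_le hz.2
            (ae_imp_of_ae_unit hf hz.1 le_rfl)
            (Continuous.intervalIntegrable (by fun_prop) _ _)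
      _ = c / (n + 1) * (1 - x ^ α) ^ (n + 1) := by
          rw [intervalIntegral.integral_const_mul,
            intervalIntegral.integral_comp_sub_left (fun y => y ^ n) 1, integral_pow]
          simp; ring
      _ ≤ c / (n + 1) * (1 - x) ^ (n + 1) := by
          have : x ≤ x ^ α := by
            simpa using Real.rpow_le_rpow_of_exponent_ge' hx'.1 hx'.2 hα.le h1
          gcongr
          linarith [hz.2]

theorem eq_zero_of_volterraOp_eq_zero {α : ℝ} (hα : 0 < α) {f : LpUnit p} (h : volterraOp p hα f = 0) :
    f = 0 := by
  have hae : volterraFun α f =ᵐ[unitMeasure] fun _ => (0 : ℂ) := by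
    have h1 := coeFn_volterraOp p hα f
    rw [h] at h1
    exact h1.symm.trans (Lp.coeFn_zero ℂ p unitMeasure)
  -- The primitive is continuous, so it vanishes everywhere and not only almost everywhere.
  have hEq : Set.EqOn (volterraFun α f) (fun _ => (0 : ℂ)) (Set.Icc 0 1) :=
    Measure.eqOn_Icc_of_ae_eq (μ := volume) zero_ne_one hae
      (continuousOn_volterraFun hα (integrable_coe p f)) continuousOn_const
  have hz : ∀ z ∈ Set.Icc (0 : ℝ) 1, ∫ y in (0 : ℝ)..z, f y = 0 := by
    intro z hz
    have := hEq (rpow_mem_unit (inv_pos.mpr hα) hz)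
    simpa [volterraFun, ← Real.rpow_mul hz.1, inv_mul_cancel₀ hα.ne'] using this
  have hd := (intervalIntegrable_of_mem (integrable_coe p f)
    (⟨zero_le_one, le_rfl⟩ : (1 : ℝ) ∈ Set.Icc (0 : ℝ) 1)).ae_hasDerivAt_integral
  refine (Lp.eq_zero_iff_ae_eq_zero (f := f)).mpr ?_
  have h0 : ∀ᵐ x ∂unitMeasure, x ≠ 0 := ae_restrict_of_ae (by simp [ae_iff])
  have h1 : ∀ᵐ x ∂unitMeasure, x ≠ 1 := ae_restrict_of_ae (by simp [ae_iff])
  filter_upwards [ae_restrict_of_ae hd, ae_mem_unit, h0, h1] with x hx hx' hx0 hx1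
  rw [Set.uIcc_of_le zero_le_one] at hx
  have hx2 := hx hx' 0 ⟨le_rfl, zero_le_one⟩
  have hev : (fun z => ∫ y in (0 : ℝ)..z, f y) =ᶠ[nhds x] fun _ => (0 : ℂ) := by
    filter_upwards [Icc_mem_nhds (lt_of_le_of_ne hx'.1 (Ne.symm hx0))
      (lt_of_le_of_ne hx'.2 hx1)] with z hz'
    exact hz z hz'
  exact hx2.unique ((hasDerivAt_const x (0 : ℂ)).congr_of_eventuallyEq hev)

theorem zero_notMem_pointSpectrum {α : ℝ} (hα : 0 < α) :
    (0 : ℂ) ∉ pointSpectrum (volterraOp p hα) := by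
  intro h
  obtain ⟨f, hf⟩ := Module.End.HasEigenvalue.exists_hasEigenvector h
  refine hf.2 (eq_zero_of_volterraOp_eq_zero p hα ?_)
  simpa using hf.apply_eq_smul

theorem pointSpectrum_subset_spectrum {E : Type*} [NormedAddCommGroup E] [NormedSpace ℂ E]
    [CompleteSpace E] (T : E →L[ℂ] E) : pointSpectrum T ⊆ spectrum ℂ T := by
  intro l hl hu
  obtain ⟨f, hf⟩ := Module.End.HasEigenvalue.exists_hasEigenvector hl
  have hfe : T f = l • f := hf.apply_eq_smul
  refine hf.2 ((ContinuousLinearMap.isUnit_iff_bijective.mp hu).1 ?_)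
  simp [Algebra.algebraMap_eq_smul_one, hfe]

theorem isUnit_add_complOp {α : ℝ} (hα : 0 < α) (h1 : α ≤ 1) {l : ℂ} (hl : l ≠ 0) :
    IsUnit (algebraMap ℂ (LpUnit p →L[ℂ] LpUnit p) l + complOp p hα) := by
  by_contra h
  have : -l ∈ spectrum ℂ (complOp p hα) := by
    rw [spectrum.mem_iff]
    intro h'
    refine h ?_
    have := h'.neg
    rwa [map_neg, neg_sub, sub_neg_eq_add, add_comm] at this
  exact hl (neg_eq_zero.mp
    (eq_zero_of_mem_spectrum_of_norm_pow_le (norm_complOp_pow_succ_le p hα h1) this))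

theorem add_complOp_injective {α : ℝ} (hα : 0 < α) (h1 : α ≤ 1) {l : ℂ} (hl : l ≠ 0)
    {f g : LpUnit p} (h : l • f + complOp p hα f = l • g + complOp p hα g) : f = g := by
  have := (ContinuousLinearMap.isUnit_iff_bijective.mp (isUnit_add_complOp p hα h1 hl)).1
  exact this (by simpa [Algebra.algebraMap_eq_smul_one] using h)

theorem exists_add_complOp_eq {α : ℝ} (hα : 0 < α) (h1 : α ≤ 1) {l : ℂ} (hl : l ≠ 0)
    (g : LpUnit p) : ∃ f, l • f + complOp p hα f = g := by
  obtain ⟨f, hf⟩ := (ContinuousLinearMap.isUnit_iff_bijective.mp (isUnit_add_complOp p hα h1 hl)).2 g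
  exact ⟨f, by simpa [Algebra.algebraMap_eq_smul_one] using hf⟩

/-- The eigenvalue equation for `T_α = ⟨·, 1⟩ 1 - S_α`, rewritten for the invertible `l + S_α`. -/
theorem volterraOp_eq_smul_iff {α : ℝ} (hα : 0 < α) {l : ℂ} {f : LpUnit p} :
    volterraOp p hα f = l • f ↔ l • f + complOp p hα f = meanCLM p f • oneLp p := by
  rw [volterraOp_apply_eq, sub_eq_iff_eq_add, eq_comm]

/-- With `u = (l + S_α)⁻¹ 1`, the rank one perturbation `l - T_α` of `l + S_α` is invertible unless
`∫ u = 1`, and in that case `u` is an eigenvector. No compactness theory is needed. -/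
theorem mem_pointSpectrum_of_mem_spectrum {α : ℝ} (hα : 0 < α) (h1 : α ≤ 1) {l : ℂ} (hl : l ≠ 0)
    (h : l ∈ spectrum ℂ (volterraOp p hα)) : l ∈ pointSpectrum (volterraOp p hα) := by
  obtain ⟨u, hu⟩ := exists_add_complOp_eq p hα h1 hl (oneLp p)
  by_cases hm : meanCLM p u = 1
  · refine Module.End.hasEigenvalue_of_hasEigenvector (x := u)
      ⟨Module.End.mem_eigenspace_iff.mpr ?_, ?_⟩
    · exact (volterraOp_eq_smul_iff p hα).mpr (by rw [hu, hm, one_smul])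
    · rintro rfl
      simp at hm
  · exfalso
    rw [spectrum.mem_iff] at h
    refine h (ContinuousLinearMap.isUnit_iff_bijective.mpr ⟨?_, ?_⟩)
    · refine (injective_iff_map_eq_zero _).mpr fun f hf => ?_
      have hf' : volterraOp p hα f = l • f :=
        (sub_eq_zero.mp (by simpa [Algebra.algebraMap_eq_smul_one] using hf)).symm
      rw [volterraOp_eq_smul_iff] at hf'
      have hfu : f = meanCLM p f • u := add_complOp_injective p hα h1 hl (by
        rw [hf', map_smul, smul_comm, ← smul_add, hu])
      have h2 : meanCLM p f = meanCLM p f * meanCLM p u := by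
        conv_lhs => rw [hfu, map_smul, smul_eq_mul]
      have h3 : meanCLM p f = 0 := by
        by_contra h0
        exact hm (mul_left_cancel₀ h0 (by rw [← h2, mul_one]))
      rw [hfu, h3, zero_smul]
    · intro g
      obtain ⟨v, hv⟩ := exists_add_complOp_eq p hα h1 hl g
      have hm' : 1 - meanCLM p u ≠ 0 := sub_ne_zero.mpr (Ne.symm hm)
      -- The coefficient solves the scalar equation `c = ∫ v + c ∫ u` left by the rank one part.
      refine ⟨v + (meanCLM p v / (1 - meanCLM p u)) • u, ?_⟩
      set c := meanCLM p v / (1 - meanCLM p u) with hc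
      have hcm : meanCLM p v + c * meanCLM p u = c := by
        rw [hc]; field_simp; ring
      have e1 : (algebraMap ℂ (LpUnit p →L[ℂ] LpUnit p) l - volterraOp p hα) (v + c • u)
          = (l • v + complOp p hα v) + c • (l • u + complOp p hα u)
            - (meanCLM p v + c * meanCLM p u) • oneLp p := by
        simp only [_root_.sub_apply, volterraOp_apply_eq,
          Algebra.algebraMap_eq_smul_one, _root_.smul_apply,
          one_apply_eq_self, map_add, map_smul]
        module
      rw [e1, hv, hu, hcm, add_sub_cancel_right]

end

/-! ### Borel summation and the series with coefficients `∏ (1 - μ α^j)` -/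

section
open Filter Topology

/-- The partial products `∏_{j<k} (1 - μ α^j)`. -/
noncomputable def qProd (α : ℝ) (μ : ℂ) (k : ℕ) : ℂ := ∏ j ∈ Finset.range k, (1 - μ * (α : ℂ) ^ j)

/-- The entire function `∑ₖ (∏_{j<k} (1 - μ α^j)) y^k / k!`, restricted to real arguments. -/
noncomputable def qSeries (α : ℝ) (μ : ℂ) (y : ℝ) : ℂ :=
  ∑' k : ℕ, qProd α μ k * ((y ^ k / k.factorial : ℝ) : ℂ)

theorem qProd_succ (α : ℝ) (μ : ℂ) (k : ℕ) :
    qProd α μ (k + 1) = qProd α μ k * (1 - μ * (α : ℂ) ^ k) := Finset.prod_range_succ _ _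

theorem summable_norm_qFactor {α : ℝ} (hα : 0 < α) (h1 : α < 1) (μ : ℂ) :
    Summable fun j : ℕ => ‖-(μ * (α : ℂ) ^ j)‖ := by
  simp only [norm_neg, norm_mul, norm_pow, Complex.norm_real, Real.norm_of_nonneg hα.le]
  exact (summable_geometric_of_lt_one hα.le h1).mul_left _

/-- The products converge, and the limit vanishes only if one of the factors does. -/
theorem exists_tendsto_qProd {α : ℝ} (hα : 0 < α) (h1 : α < 1) (μ : ℂ) :
    ∃ A : ℂ, Tendsto (qProd α μ) atTop (𝓝 A) ∧ (A = 0 ↔ ∃ n : ℕ, μ * (α : ℂ) ^ n = 1) := by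
  have hs := summable_norm_qFactor hα h1 μ
  have hm := (multipliable_one_add_of_summable hs).tendsto_prod_tprod_nat
  simp only [← sub_eq_add_neg] at hm
  refine ⟨_, hm, fun h => ?_, ?_⟩
  · by_contra! hn
    refine tprod_one_add_ne_zero_of_summable (fun i => ?_) hs
      (by simpa only [← sub_eq_add_neg] using h)
    rw [← sub_eq_add_neg]
    exact sub_ne_zero.mpr (Ne.symm (hn i))
  · rintro ⟨n, hn⟩
    refine tendsto_nhds_unique hm (tendsto_const_nhds.congr' ?_)
    filter_upwards [eventually_gt_atTop n] with k hk
    exact (Finset.prod_eq_zero (Finset.mem_range.mpr hk) (by rw [hn, sub_self])).symm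

theorem exists_norm_qProd_le {α : ℝ} (hα : 0 < α) (h1 : α < 1) (μ : ℂ) :
    ∃ M : ℝ, 0 ≤ M ∧ ∀ k, ‖qProd α μ k‖ ≤ M := by
  obtain ⟨A, hA, -⟩ := exists_tendsto_qProd hα h1 μ
  obtain ⟨M, hM⟩ := hA.norm.bddAbove_range
  exact ⟨M, (norm_nonneg _).trans (hM ⟨0, rfl⟩), fun k => hM ⟨k, rfl⟩⟩

theorem hasSum_pow_div_factorial (y : ℝ) :
    HasSum (fun k : ℕ => y ^ k / k.factorial) (Real.exp y) := by
  rw [Real.exp_eq_exp_ℝ]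
  exact NormedSpace.expSeries_div_hasSum_exp y

theorem hasSum_ite_mem_range (N : ℕ) (u : ℕ → ℝ) :
    HasSum (fun k => if k ∈ Finset.range N then u k else 0) (∑ k ∈ Finset.range N, u k) := by
  rw [Finset.sum_congr rfl fun k hk => (if_pos hk).symm]
  exact hasSum_sum_of_ne_finset_zero fun b hb => if_neg hb

theorem summable_pow_div_factorial_mul {a : ℕ → ℂ} {M : ℝ} (hM : ∀ k, ‖a k‖ ≤ M) (y : ℝ) :
    Summable fun k : ℕ => a k * ((y ^ k / k.factorial : ℝ) : ℂ) := by
  refine Summable.of_norm_bounded ((Real.summable_pow_div_factorial |y|).mul_left M) fun k => ?_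
  rw [norm_mul, Complex.norm_real, norm_div, norm_pow, Real.norm_eq_abs,
    Real.norm_of_nonneg (Nat.cast_nonneg _)]
  gcongr
  exact hM k

theorem norm_tsum_pow_div_factorial_le {a : ℕ → ℂ} {M : ℝ} (hM : ∀ k, ‖a k‖ ≤ M) {y : ℝ}
    (hy : 0 ≤ y) : ‖∑' k : ℕ, a k * ((y ^ k / k.factorial : ℝ) : ℂ)‖ ≤ M * Real.exp y := by
  refine tsum_of_norm_bounded ((hasSum_pow_div_factorial y).mul_left M) fun k => ?_
  rw [norm_mul, Complex.norm_real, Real.norm_of_nonneg (by positivity)]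
  gcongr
  exact hM k

/-- Borel summation is regular: if `a k → A` then `e^{-y} ∑ₖ a k y^k / k! → A` as `y → ∞`. -/
theorem tendsto_exp_neg_mul_tsum {a : ℕ → ℂ} {A : ℂ} (ha : Tendsto a atTop (𝓝 A)) :
    Tendsto (fun y : ℝ => ((Real.exp (-y) : ℝ) : ℂ) *
      ∑' k : ℕ, a k * ((y ^ k / k.factorial : ℝ) : ℂ)) atTop (𝓝 A) := by
  obtain ⟨M, hM⟩ : ∃ M, ∀ k, ‖a k‖ ≤ M := by
    obtain ⟨M, hM⟩ := ha.norm.bddAbove_range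
    exact ⟨M, fun k => hM ⟨k, rfl⟩⟩
  rw [Metric.tendsto_atTop]
  intro ε hε
  obtain ⟨N, hN⟩ := Metric.tendsto_atTop.mp ha (ε / 2) (half_pos hε)
  -- Only the first `N` terms of `a - A` exceed `ε / 2`; they contribute `e^{-y}` times a polynomial.
  have hpoly : Tendsto (fun y : ℝ => Real.exp (-y) *
      ∑ k ∈ Finset.range N, ‖a k - A‖ * (y ^ k / k.factorial)) atTop (𝓝 0) := by
    simp_rw [Finset.mul_sum]
    rw [← Finset.sum_const_zero (s := Finset.range N)]
    refine tendsto_finsetSum _ fun k _ => ?_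
    have := (Real.tendsto_pow_mul_exp_neg_atTop_nhds_zero k).const_mul (‖a k - A‖ / k.factorial)
    rw [mul_zero] at this
    refine this.congr fun y => ?_
    ring
  obtain ⟨Y, hY⟩ := Metric.tendsto_atTop.mp hpoly (ε / 2) (half_pos hε)
  refine ⟨max Y 0, fun y hy => ?_⟩
  have hy0 : 0 ≤ y := (le_max_right _ _).trans hy
  have hexp := hasSum_pow_div_factorial y
  have hS := summable_pow_div_factorial_mul hM y
  have hA : HasSum (fun k : ℕ => A * ((y ^ k / k.factorial : ℝ) : ℂ)) (A * (Real.exp y : ℝ)) :=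
    (Complex.hasSum_ofReal.mpr hexp).mul_left A
  have hdiff : ((Real.exp (-y) : ℝ) : ℂ) * ∑' k : ℕ, a k * ((y ^ k / k.factorial : ℝ) : ℂ) - A
      = ((Real.exp (-y) : ℝ) : ℂ) * ∑' k : ℕ, (a k - A) * ((y ^ k / k.factorial : ℝ) : ℂ) := by
    simp_rw [sub_mul]
    rw [hS.tsum_sub hA.summable, hA.tsum_eq, mul_sub, mul_left_comm, ← Complex.ofReal_mul,
      ← Real.exp_add]
    simp
  rw [dist_eq_norm, hdiff, norm_mul, Complex.norm_real, Real.norm_of_nonneg (Real.exp_pos _).le]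
  have hfin := hasSum_ite_mem_range N fun k => ‖a k - A‖ * (y ^ k / k.factorial)
  have hle : ‖∑' k : ℕ, (a k - A) * ((y ^ k / k.factorial : ℝ) : ℂ)‖
      ≤ (∑ k ∈ Finset.range N, ‖a k - A‖ * (y ^ k / k.factorial)) + ε / 2 * Real.exp y := by
    refine tsum_of_norm_bounded (hfin.add (hexp.mul_left (ε / 2))) fun k => ?_
    rw [norm_mul, Complex.norm_real, Real.norm_of_nonneg (by positivity)]
    split_ifs with hk
    · exact le_add_of_nonneg_right (by positivity)
    · rw [zero_add]
      have := (hN k (not_lt.mp fun h => hk (Finset.mem_range.mpr h))).le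
      rw [dist_eq_norm] at this
      gcongr
  have h2 := hY y ((le_max_left _ _).trans hy)
  rw [Real.dist_eq, sub_zero] at h2
  calc Real.exp (-y) * ‖∑' k : ℕ, (a k - A) * ((y ^ k / k.factorial : ℝ) : ℂ)‖
      ≤ Real.exp (-y) * ((∑ k ∈ Finset.range N, ‖a k - A‖ * (y ^ k / k.factorial))
          + ε / 2 * Real.exp y) := by gcongr
    _ = Real.exp (-y) * (∑ k ∈ Finset.range N, ‖a k - A‖ * (y ^ k / k.factorial)) + ε / 2 := by
        rw [mul_add, mul_left_comm, ← Real.exp_add]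
        simp
    _ < ε / 2 + ε / 2 := by linarith [le_abs_self (Real.exp (-y) *
          ∑ k ∈ Finset.range N, ‖a k - A‖ * (y ^ k / k.factorial))]
    _ = ε := by ring

theorem hasDerivAt_tsum_pow_div_factorial {a : ℕ → ℂ} {M : ℝ} (hM : ∀ k, ‖a k‖ ≤ M) (y : ℝ) :
    HasDerivAt (fun y : ℝ => ∑' k : ℕ, a k * ((y ^ k / k.factorial : ℝ) : ℂ))
      (∑' k : ℕ, a (k + 1) * ((y ^ k / k.factorial : ℝ) : ℂ)) y := by
  have hM0 : 0 ≤ M := (norm_nonneg _).trans (hM 0)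
  set R : ℝ := |y| + 1 with hR
  have hR0 : 0 < R := by positivity
  have hbase : Summable fun k : ℕ => M * (R ^ (k - 1) * (k / k.factorial : ℝ)) := by
    refine Summable.mul_left M ((summable_nat_add_iff 1).mp ?_)
    refine (Real.summable_pow_div_factorial R).congr fun k => ?_
    rw [Nat.factorial_succ]
    push_cast
    field_simp
  have hd := hasDerivAt_tsum_of_isPreconnected (𝕜 := ℝ)
    (g := fun (k : ℕ) (y : ℝ) => a k * ((y ^ k / k.factorial : ℝ) : ℂ))
    (g' := fun (k : ℕ) (y : ℝ) => a k * ((k * y ^ (k - 1) / k.factorial : ℝ) : ℂ))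
    (t := Metric.ball (0 : ℝ) R) (y₀ := 0) (y := y) hbase Metric.isOpen_ball
    (convex_ball _ _).isPreconnected
    (fun k z _ => (((hasDerivAt_pow k z).div_const _).ofReal_comp).const_mul _)
    (fun k z hz => by
      have hz' : |z| ≤ R := by simpa using (Metric.mem_ball.mp hz).le
      rw [norm_mul, Complex.norm_real, norm_div, norm_mul, norm_pow, Real.norm_natCast,
        Real.norm_eq_abs, Real.norm_natCast, mul_comm (k : ℝ), mul_div_assoc]
      gcongr
      exact hM k)
    (Metric.mem_ball_self hR0) (summable_pow_div_factorial_mul hM 0)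
    (by simp [hR])
  refine hd.congr_deriv ?_
  rw [Summable.tsum_eq_zero_add]
  · simp only [Nat.cast_zero, zero_mul, zero_div, Complex.ofReal_zero, mul_zero, zero_add]
    refine tsum_congr fun k => ?_
    congr 2
    rw [Nat.factorial_succ]
    push_cast
    field_simp
  · refine (summable_nat_add_iff 1).mp ?_
    refine (summable_pow_div_factorial_mul (a := fun k => a (k + 1)) (fun k => hM _) y).congr
      fun k => ?_
    congr 2
    rw [Nat.factorial_succ]
    push_cast
    field_simp

end

/-! ### The explicit solution and the point spectrum -/

section
open Filter Topology

theorem hasDerivAt_qSeries {α : ℝ} (hα : 0 < α) (h1 : α < 1) (μ : ℂ) (y : ℝ) :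
    HasDerivAt (qSeries α μ) (qSeries α μ y - μ * qSeries α μ (α * y)) y := by
  obtain ⟨M, -, hM⟩ := exists_norm_qProd_le hα h1 μ
  refine (hasDerivAt_tsum_pow_div_factorial hM y).congr_deriv ?_
  rw [qSeries, qSeries, ← tsum_mul_left,
    ← (summable_pow_div_factorial_mul hM y).tsum_sub
      ((summable_pow_div_factorial_mul hM (α * y)).mul_left μ)]
  refine tsum_congr fun k => ?_
  rw [qProd_succ]
  push_cast
  ring

theorem qSeries_zero (α : ℝ) (μ : ℂ) : qSeries α μ 0 = 1 := by
  rw [qSeries, tsum_eq_single 0 fun k hk => by simp [hk]]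
  simp [qProd]

/-- The solution `x^s ∑ₖ (∏_{j<k} (1 - μ α^j)) (-s log x)^k / k!`, with `s = α / (1 - α)`, of the
functional differential equation `g'(x) = μ s x^(α-1) g(x^α)` normalised by `g 1 = 1`. -/
noncomputable def pantographSol (α : ℝ) (μ : ℂ) (x : ℝ) : ℂ :=
  ((x ^ (α / (1 - α)) : ℝ) : ℂ) * qSeries α μ (-(α / (1 - α)) * Real.log x)

theorem pantographSol_one (α : ℝ) (μ : ℂ) : pantographSol α μ 1 = 1 := by
  simp [pantographSol, qSeries_zero]

theorem hasDerivAt_pantographSol {α : ℝ} (hα : 0 < α) (h1 : α < 1) (μ : ℂ) {x : ℝ} (hx : 0 < x) :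
    HasDerivAt (pantographSol α μ)
      (μ * ((α / (1 - α) * x ^ (α - 1) : ℝ) : ℂ) * pantographSol α μ (x ^ α)) x := by
  set s := α / (1 - α) with hs
  have h1' : (1 - α) ≠ 0 := (sub_pos.mpr h1).ne'
  have hp : HasDerivAt (fun x : ℝ => ((x ^ s : ℝ) : ℂ)) ((s * x ^ (s - 1) : ℝ) : ℂ) x :=
    (Real.hasDerivAt_rpow_const (Or.inl hx.ne')).ofReal_comp
  have hl : HasDerivAt (fun x : ℝ => -s * Real.log x) (-s * x⁻¹) x :=
    (Real.hasDerivAt_log hx.ne').const_mul _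
  have hq := (hasDerivAt_qSeries hα h1 μ (-s * Real.log x)).scomp x hl
  refine (hp.mul hq).congr_deriv ?_
  have e1 : (x ^ α) ^ s = x ^ (α * s) := by rw [← Real.rpow_mul hx.le]
  have e2 : -s * Real.log (x ^ α) = α * (-s * Real.log x) := by rw [Real.log_rpow hx]; ring
  have e3 : x ^ (α - 1) * x ^ (α * s) = x ^ (s - 1) := by
    rw [← Real.rpow_add hx]; congr 1; rw [hs]; field_simp; ring
  have e4 : x ^ s = x ^ (s - 1) * x := by
    rw [Real.rpow_sub_one hx.ne']; field_simp
  rw [pantographSol, ← hs, e1, e2, ← e3]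
  rw [← e3] at e4
  rw [e4]
  simp only [Complex.real_smul, Function.comp_apply]
  have hxc : (x : ℂ) ≠ 0 := by exact_mod_cast hx.ne'
  push_cast
  field_simp
  ring

theorem continuousOn_pantographSol {α : ℝ} (hα : 0 < α) (h1 : α < 1) (μ : ℂ) :
    ContinuousOn (pantographSol α μ) (Set.Ioi 0) :=
  fun _ hx => (hasDerivAt_pantographSol hα h1 μ hx).continuousAt.continuousWithinAt

/-- The functional differential equation in integrated form: the left side has derivative zero on
`(0, ∞)` and equals `l` at `x = 1`. It says `(l + S_α) g = l • 1`. -/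
theorem pantographSol_integral_eq {α : ℝ} (hα : 0 < α) (h1 : α < 1) {l μ : ℂ}
    (hl : l * μ = ((1 - α : ℝ) : ℂ)) {x : ℝ} (hx : 0 < x) :
    l * pantographSol α μ x + ∫ y in (x ^ α)..1, pantographSol α μ y = l := by
  have hd : ∀ z ∈ Set.Ioi (0 : ℝ), HasDerivAt
      (fun x : ℝ => l * pantographSol α μ x + ∫ y in (x ^ α)..1, pantographSol α μ y) 0 z := by
    intro z hz
    have hzα : 0 < z ^ α := Real.rpow_pos_of_pos hz α
    have hcont := continuousOn_pantographSol hα h1 μ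
    have hint : IntervalIntegrable (pantographSol α μ) volume (z ^ α) 1 :=
      (hcont.mono fun t ht => lt_of_lt_of_le (lt_min hzα one_pos) ht.1).intervalIntegrable
    have hI : HasDerivAt (fun w : ℝ => ∫ y in w..1, pantographSol α μ y)
        (-pantographSol α μ (z ^ α)) (z ^ α) :=
      intervalIntegral.integral_hasDerivAt_left hint
        (hcont.stronglyMeasurableAtFilter isOpen_Ioi _ hzα)
        (hcont.continuousAt (Ioi_mem_nhds hzα))
    have hr : HasDerivAt (fun x : ℝ => x ^ α) (α * z ^ (α - 1)) z :=
      Real.hasDerivAt_rpow_const (Or.inl hz.ne')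
    refine (((hasDerivAt_pantographSol hα h1 μ hz).const_mul l).add
      (hI.scomp z hr)).congr_deriv ?_
    have h1' : ((1 : ℂ) - α) ≠ 0 := by exact_mod_cast (sub_pos.mpr h1).ne'
    simp only [Complex.real_smul]
    push_cast at hl ⊢
    rw [← mul_assoc, ← mul_assoc, hl]
    field_simp
    ring
  have := isOpen_Ioi.is_const_of_deriv_eq_zero isPreconnected_Ioi
    (fun z hz => (hd z hz).differentiableAt.differentiableWithinAt)
    (fun z hz => (hd z hz).deriv) (Set.mem_Ioi.mpr hx) (Set.mem_Ioi.mpr one_pos)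
  simpa [pantographSol_one] using this

theorem exists_norm_pantographSol_le {α : ℝ} (hα : 0 < α) (h1 : α < 1) (μ : ℂ) :
    ∃ M : ℝ, ∀ x ∈ Set.Icc (0 : ℝ) 1, ‖pantographSol α μ x‖ ≤ M := by
  obtain ⟨M, hM0, hM⟩ := exists_norm_qProd_le hα h1 μ
  have hs : 0 < α / (1 - α) := div_pos hα (sub_pos.mpr h1)
  refine ⟨M, fun x hx => ?_⟩
  rcases hx.1.eq_or_lt with rfl | hx0
  · simpa [pantographSol, Real.zero_rpow hs.ne'] using hM0
  · rw [pantographSol, norm_mul, Complex.norm_real,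
      Real.norm_of_nonneg (Real.rpow_nonneg hx.1 _)]
    have hy : 0 ≤ -(α / (1 - α)) * Real.log x :=
      mul_nonneg_of_nonpos_of_nonpos (neg_nonpos.mpr hs.le) (Real.log_nonpos hx.1 hx.2)
    calc _ ≤ x ^ (α / (1 - α)) * (M * Real.exp (-(α / (1 - α)) * Real.log x)) :=
          mul_le_mul_of_nonneg_left (norm_tsum_pow_div_factorial_le hM hy)
            (Real.rpow_nonneg hx.1 _)
      _ = M := by
          rw [Real.rpow_def_of_pos hx0, mul_left_comm, ← Real.exp_add]
          ring_nf
          simp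

theorem memLp_pantographSol (p : ℝ≥0∞) {α : ℝ} (hα : 0 < α) (h1 : α < 1) (μ : ℂ) :
    MemLp (pantographSol α μ) p unitMeasure := by
  obtain ⟨M, hM⟩ := exists_norm_pantographSol_le hα h1 μ
  refine MemLp.of_bound ?_ M (ae_mem_unit.mono hM)
  rw [unitMeasure, ← Measure.restrict_congr_set (Ioc_ae_eq_Icc (a := (0 : ℝ)) (b := 1))]
  exact ((continuousOn_pantographSol hα h1 μ).mono fun x hx => hx.1).aestronglyMeasurable
    measurableSet_Ioc

/-- With `y = -s log x`, the solution is `e^{-y} ∑ₖ a_k y^k / k!`, so its limit at `0` is `lim a_k`. -/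
theorem tendsto_pantographSol {α : ℝ} (hα : 0 < α) (h1 : α < 1) {μ A : ℂ}
    (hA : Tendsto (qProd α μ) atTop (𝓝 A)) :
    Tendsto (pantographSol α μ) (𝓝[>] 0) (𝓝 A) := by
  have hs : 0 < α / (1 - α) := div_pos hα (sub_pos.mpr h1)
  have hy : Tendsto (fun x : ℝ => -(α / (1 - α)) * Real.log x) (𝓝[>] 0) atTop :=
    Real.tendsto_log_nhdsGT_zero.const_mul_atBot_of_neg (neg_neg_of_pos hs)
  refine ((tendsto_exp_neg_mul_tsum hA).comp hy).congr' ?_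
  filter_upwards [self_mem_nhdsWithin] with x hx
  rw [pantographSol, Real.rpow_def_of_pos hx, Function.comp_apply, qSeries]
  ring_nf

/-- Obtained by letting `x → 0` in `pantographSol_integral_eq`. -/
theorem integral_pantographSol {α : ℝ} (hα : 0 < α) (h1 : α < 1) {l μ A : ℂ}
    (hl : l * μ = ((1 - α : ℝ) : ℂ)) (hA : Tendsto (qProd α μ) atTop (𝓝 A)) :
    ∫ y, pantographSol α μ y ∂unitMeasure = l * (1 - A) := by
  have hint : Integrable (pantographSol α μ) unitMeasure :=
    (memLp_pantographSol 1 hα h1 μ).integrable le_rfl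
  have hv : Tendsto (volterraFun α (pantographSol α μ)) (𝓝[>] 0) (𝓝 0) := by
    have := (continuousOn_volterraFun hα hint) 0 ⟨le_rfl, zero_le_one⟩
    have h0 : volterraFun α (pantographSol α μ) 0 = 0 := by
      simp [volterraFun, Real.zero_rpow hα.ne']
    rw [ContinuousWithinAt, h0] at this
    exact this.mono_left (nhdsWithin_le_of_mem (Icc_mem_nhdsGT zero_lt_one))
  have hlim := ((tendsto_pantographSol hα h1 hA).const_mul l).sub hv
  have heq : (fun x => l * pantographSol α μ x - volterraFun α (pantographSol α μ) x)
      =ᶠ[𝓝[>] 0] fun _ => l - ∫ y, pantographSol α μ y ∂unitMeasure := by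
    filter_upwards [Ioc_mem_nhdsGT zero_lt_one] with x hx
    have h2 := pantographSol_integral_eq hα h1 hl hx.1
    rw [← integral_sub_volterraFun hα hint ⟨hx.1.le, hx.2⟩] at h2
    linear_combination h2
  have := tendsto_nhds_unique (hlim.congr' heq) tendsto_const_nhds
  linear_combination this

variable (p : ℝ≥0∞)

/-- `pantographSol α μ` as an element of `L^p[0,1]`. -/
noncomputable def pantographLp {α : ℝ} (hα : 0 < α) (h1 : α < 1) (μ : ℂ) : LpUnit p :=
  (memLp_pantographSol p hα h1 μ).toLp (pantographSol α μ)

variable [hp : Fact (1 ≤ p)]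

theorem smul_add_complOp_pantographLp {α : ℝ} (hα : 0 < α) (h1 : α < 1) {l μ : ℂ}
    (hl : l * μ = ((1 - α : ℝ) : ℂ)) :
    l • pantographLp p hα h1 μ + complOp p hα (pantographLp p hα h1 μ) = l • oneLp p := by
  have hg : pantographLp p hα h1 μ =ᵐ[unitMeasure] pantographSol α μ := MemLp.coeFn_toLp _
  refine Lp.ext ?_
  have h0 : ∀ᵐ x ∂unitMeasure, x ≠ 0 := ae_restrict_of_ae (by simp [ae_iff])
  filter_upwards [Lp.coeFn_add (l • pantographLp p hα h1 μ)
    (complOp p hα (pantographLp p hα h1 μ)), Lp.coeFn_smul l (pantographLp p hα h1 μ),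
    Lp.coeFn_smul l (oneLp p), coeFn_oneLp p, coeFn_complOp p hα (pantographLp p hα h1 μ), hg,
    ae_mem_unit, h0] with x e1 e2 e3 e4 e5 e6 hx hx0
  have hz := rpow_mem_unit hα hx
  have e7 : ∫ y in (x ^ α)..1, pantographLp p hα h1 μ y
      = ∫ y in (x ^ α)..1, pantographSol α μ y := by
    rw [intervalIntegral.integral_of_le hz.2, intervalIntegral.integral_of_le hz.2]
    exact integral_congr_ae (ae_restrict_of_ae_restrict_of_subset (t := Set.Icc (0 : ℝ) 1)
      (fun y hy => ⟨hz.1.trans hy.1.le, hy.2⟩) hg)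
  rw [e1, Pi.add_apply, e2, Pi.smul_apply, e5, e3, Pi.smul_apply, e4, e6, e7, smul_eq_mul,
    smul_eq_mul, mul_one]
  exact pantographSol_integral_eq hα h1 hl (lt_of_le_of_ne hx.1 (Ne.symm hx0))

theorem meanCLM_pantographLp {α : ℝ} (hα : 0 < α) (h1 : α < 1) {l μ A : ℂ}
    (hl : l * μ = ((1 - α : ℝ) : ℂ)) (hA : Tendsto (qProd α μ) atTop (𝓝 A)) :
    meanCLM p (pantographLp p hα h1 μ) = l * (1 - A) := by
  rw [meanCLM_apply, ← integral_pantographSol hα h1 hl hA]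
  exact integral_congr_ae (MemLp.coeFn_toLp _)

theorem eq_smul_pantographLp {α : ℝ} (hα : 0 < α) (h1 : α < 1) {l μ : ℂ} (hl0 : l ≠ 0)
    (hl : l * μ = ((1 - α : ℝ) : ℂ)) {f : LpUnit p} (hf : volterraOp p hα f = l • f) :
    f = (meanCLM p f / l) • pantographLp p hα h1 μ := by
  refine add_complOp_injective p hα h1.le hl0 ?_
  rw [(volterraOp_eq_smul_iff p hα).mp hf, map_smul, smul_comm, ← smul_add,
    smul_add_complOp_pantographLp p hα h1 hl, smul_smul, div_mul_cancel₀ _ hl0]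

theorem volterraOp_pantographLp {α : ℝ} (hα : 0 < α) (h1 : α < 1) {l μ : ℂ}
    (hl : l * μ = ((1 - α : ℝ) : ℂ)) (hμ : ∃ n : ℕ, μ * (α : ℂ) ^ n = 1) :
    volterraOp p hα (pantographLp p hα h1 μ) = l • pantographLp p hα h1 μ ∧
      meanCLM p (pantographLp p hα h1 μ) = l := by
  obtain ⟨A, hA, hA0⟩ := exists_tendsto_qProd hα h1 μ
  have hm := meanCLM_pantographLp p hα h1 hl hA
  rw [hA0.mpr hμ, sub_zero, mul_one] at hm
  refine ⟨(volterraOp_eq_smul_iff p hα).mpr ?_, hm⟩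
  rw [smul_add_complOp_pantographLp p hα h1 hl, hm]

/-- An eigenvector is a nonzero multiple of `g = pantographLp`, which forces `∫ g = l`. As
`∫ g = l (1 - ∏ (1 - μ α^j))`, the infinite product must vanish. -/
theorem exists_eq_one_of_mem_pointSpectrum {α : ℝ} (hα : 0 < α) (h1 : α < 1) {l μ : ℂ}
    (hl0 : l ≠ 0) (hl : l * μ = ((1 - α : ℝ) : ℂ)) (h : l ∈ pointSpectrum (volterraOp p hα)) :
    ∃ n : ℕ, μ * (α : ℂ) ^ n = 1 := by
  obtain ⟨A, hA, hA0⟩ := exists_tendsto_qProd hα h1 μ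
  refine hA0.mp ?_
  obtain ⟨f, hf⟩ := Module.End.HasEigenvalue.exists_hasEigenvector h
  have hfg := eq_smul_pantographLp p hα h1 hl0 hl (f := f) hf.apply_eq_smul
  have hm0 : meanCLM p f ≠ 0 := fun h0 => hf.2 (by rw [hfg, h0, zero_div, zero_smul])
  have h2 : meanCLM p f = meanCLM p f / l * (l * (1 - A)) := by
    conv_lhs => rw [hfg, map_smul, meanCLM_pantographLp p hα h1 hl hA, smul_eq_mul]
  rw [← mul_assoc, div_mul_cancel₀ _ hl0] at h2
  have h3 : meanCLM p f * A = 0 := by linear_combination h2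
  exact (mul_eq_zero.mp h3).resolve_left hm0

theorem eigenspace_volterraOp_eq_span {α : ℝ} (hα : 0 < α) (h1 : α < 1) {l μ : ℂ} (hl0 : l ≠ 0)
    (hl : l * μ = ((1 - α : ℝ) : ℂ)) (hμ : ∃ n : ℕ, μ * (α : ℂ) ^ n = 1) :
    Module.End.eigenspace (volterraOp p hα : LpUnit p →ₗ[ℂ] LpUnit p) l
      = Submodule.span ℂ {pantographLp p hα h1 μ} := by
  ext f
  rw [Module.End.mem_eigenspace_iff, Submodule.mem_span_singleton]
  constructor
  · intro hf
    exact ⟨_, (eq_smul_pantographLp p hα h1 hl0 hl hf).symm⟩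
  · rintro ⟨c, rfl⟩
    rw [map_smul, ContinuousLinearMap.coe_coe, (volterraOp_pantographLp p hα h1 hl hμ).1,
      smul_comm]

theorem pointSpectrum_volterraOp_eq {α : ℝ} (hα : 0 < α) (h1 : α < 1) :
    pointSpectrum (volterraOp p hα)
      = Set.range fun n : ℕ => ((α ^ n * (1 - α) : ℝ) : ℂ) := by
  have hα' : (α : ℂ) ≠ 0 := by exact_mod_cast hα.ne'
  have h1' : ((1 : ℂ) - α) ≠ 0 := by exact_mod_cast (sub_pos.mpr h1).ne'
  ext l
  by_cases hl0 : l = 0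
  · subst hl0
    refine iff_of_false (zero_notMem_pointSpectrum p hα) ?_
    rintro ⟨n, hn⟩
    dsimp only at hn
    refine (mul_pos (pow_pos hα n) (sub_pos.mpr h1)).ne' ?_
    exact_mod_cast hn
  have hl : l * (((1 - α : ℝ) : ℂ) / l) = ((1 - α : ℝ) : ℂ) := mul_div_cancel₀ _ hl0
  constructor
  · intro h
    obtain ⟨n, hn⟩ := exists_eq_one_of_mem_pointSpectrum p hα h1 hl0 hl h
    refine ⟨n, ?_⟩
    rw [div_mul_eq_mul_div, div_eq_one_iff_eq hl0] at hn
    rw [← hn]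
    push_cast
    ring
  · rintro ⟨n, rfl⟩
    have hμ : ∃ m : ℕ, ((1 - α : ℝ) : ℂ) / ((α ^ n * (1 - α) : ℝ) : ℂ) * (α : ℂ) ^ m = 1 := by
      refine ⟨n, ?_⟩
      push_cast
      field_simp
    have hT := volterraOp_pantographLp p hα h1 hl hμ
    refine Module.End.hasEigenvalue_of_hasEigenvector (x := pantographLp p hα h1 _)
      ⟨Module.End.mem_eigenspace_iff.mpr hT.1, fun h0 => ?_⟩
    have h2 := hT.2
    rw [h0, map_zero] at h2
    exact hl0 h2.symm

end

/-! ### Eigenfunctions and their completeness -/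

section

theorem one_sub_inv_ne_zero {α : ℝ} (hα : 0 < α) (h1 : α < 1) : (1 - α⁻¹) ≠ 0 :=
  (sub_neg.mpr ((one_lt_inv₀ hα).mpr h1)).ne

theorem degree_eigenPoly {α : ℝ} (hα : 0 < α) (h1 : α < 1) (n : ℕ) :
    (eigenPoly α n).degree = n := by
  refine le_antisymm ?_ ?_
  · refine (Polynomial.degree_sum_le _ _).trans (Finset.sup_le fun k hk => ?_)
    refine (Polynomial.degree_monomial_le _ _).trans ?_
    exact_mod_cast Nat.lt_succ_iff.mp (Finset.mem_range.mp hk)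
  · refine Polynomial.le_degree_of_ne_zero ?_
    rw [eigenPoly, Polynomial.finsetSum_coeff]
    simp only [Polynomial.coeff_monomial, Finset.sum_ite_eq', Finset.mem_range,
      Nat.lt_succ_self, if_true]
    refine div_ne_zero (Finset.prod_ne_zero_iff.mpr fun j hj => ?_) (by positivity)
    refine div_ne_zero ?_ (one_sub_inv_ne_zero hα h1)
    have hjn : (j : ℤ) - n < 0 := by
      have := Finset.mem_range.mp hj
      omega
    exact (sub_neg.mpr (one_lt_zpow_of_neg₀ hα h1 hjn)).ne

/-- When `μ = α^(-n)` the coefficients `∏_{j<k} (1 - μ α^j)` vanish for `k > n`, and the series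
terminates in the polynomial `eigenPoly α n`. -/
theorem eigenFun_eq_pantographSol {α : ℝ} (hα : 0 < α) (h1 : α < 1) {n : ℕ} {μ : ℂ}
    (hμ : μ * (α : ℂ) ^ n = 1) (x : ℝ) : eigenFun α n x = pantographSol α μ x := by
  have hα' : (α : ℂ) ≠ 0 := by exact_mod_cast hα.ne'
  have h1' : ((1 : ℂ) - α) ≠ 0 := by exact_mod_cast (sub_pos.mpr h1).ne'
  have hμ' : μ = ((α : ℂ) ^ n)⁻¹ := eq_inv_of_mul_eq_one_left hμ
  rw [eigenFun, pantographSol, Complex.ofReal_mul]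
  congr 1
  rw [qSeries, tsum_eq_sum (s := Finset.range (n + 1)) fun k hk => ?_]
  · rw [eigenPoly, Polynomial.eval_finsetSum, Complex.ofReal_sum]
    refine Finset.sum_congr rfl fun k _ => ?_
    have hs : -(α / (1 - α)) = (1 - α⁻¹)⁻¹ := by
      have := (sub_pos.mpr h1).ne'
      have h2 := one_sub_inv_ne_zero hα h1
      refine eq_inv_of_mul_eq_one_left ?_
      field_simp
      ring
    have hprod : qProd α μ k
        = ((∏ j ∈ Finset.range k, (1 - α ^ ((j : ℤ) - (n : ℤ))) : ℝ) : ℂ) := by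
      rw [qProd, Complex.ofReal_prod]
      refine Finset.prod_congr rfl fun j _ => ?_
      rw [hμ', Complex.ofReal_sub, Complex.ofReal_zpow, zpow_sub₀ hα']
      simp [div_eq_inv_mul]
    rw [hprod, Polynomial.eval_monomial, Finset.prod_div_distrib, Finset.prod_const,
      Finset.card_range, hs, ← Complex.ofReal_mul]
    congr 1
    rw [mul_pow, inv_pow]
    ring
  · have : n < k := by simpa using hk
    rw [qProd, Finset.prod_eq_zero (Finset.mem_range.mpr this) (by rw [hμ, sub_self]), zero_mul]

/-- The class of `f` exists in `L^p[0,1]` and belongs to `K`. -/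
def ClassMem {p : ℝ≥0∞} (K : Submodule ℂ (LpUnit p)) (f : ℝ → ℂ) : Prop :=
  ∃ hf : MemLp f p unitMeasure, hf.toLp f ∈ K

namespace ClassMem
variable {p : ℝ≥0∞} {K : Submodule ℂ (LpUnit p)} {f g : ℝ → ℂ}

theorem congr (hf : ClassMem K f) (h : ∀ x ∈ Set.Icc (0 : ℝ) 1, f x = g x) : ClassMem K g := by
  obtain ⟨hf, hK⟩ := hf
  have hae : f =ᵐ[unitMeasure] g := ae_mem_unit.mono h
  refine ⟨hf.ae_eq hae, ?_⟩
  rwa [MemLp.toLp_congr (hf.ae_eq hae) hf hae.symm]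

theorem add (hf : ClassMem K f) (hg : ClassMem K g) : ClassMem K (f + g) := by
  obtain ⟨hf, hfK⟩ := hf
  obtain ⟨hg, hgK⟩ := hg
  exact ⟨hf.add hg, by rw [MemLp.toLp_add hf hg]; exact K.add_mem hfK hgK⟩

theorem const_mul (c : ℂ) (hf : ClassMem K f) : ClassMem K fun x => c * f x := by
  obtain ⟨hf, hfK⟩ := hf
  exact ⟨hf.const_smul c, by
    have := K.smul_mem c hfK
    rwa [← MemLp.toLp_const_smul] at this⟩

theorem zero : ClassMem K fun _ => (0 : ℂ) :=
  ⟨MemLp.zero', by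
    have : (MemLp.zero' : MemLp (fun _ : ℝ => (0 : ℂ)) p unitMeasure).toLp _ = 0 :=
      MemLp.toLp_zero _
    rw [this]
    exact K.zero_mem⟩

theorem sum {ι : Type*} (s : Finset ι) {F : ι → ℝ → ℂ} (h : ∀ i ∈ s, ClassMem K (F i)) :
    ClassMem K fun x => ∑ i ∈ s, F i x := by
  classical
  induction s using Finset.induction_on with
  | empty => simpa using zero
  | insert a s ha ih =>
    simp only [Finset.sum_insert ha]
    exact (h a (Finset.mem_insert_self a s)).add
      (ih fun i hi => h i (Finset.mem_insert_of_mem hi))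

theorem of_uniform_approx [hp : Fact (1 ≤ p)] (hK : IsClosed (K : Set (LpUnit p)))
    (hf : MemLp f p unitMeasure)
    (h : ∀ ε > 0, ∃ g, ClassMem K g ∧ ∀ x ∈ Set.Icc (0 : ℝ) 1, ‖f x - g x‖ ≤ ε) :
    ClassMem K f := by
  refine ⟨hf, ?_⟩
  rw [← SetLike.mem_coe, ← hK.closure_eq, Metric.mem_closure_iff]
  intro ε hε
  obtain ⟨g, ⟨hg, hgK⟩, hfg⟩ := h (ε / 2) (half_pos hε)
  refine ⟨_, hgK, lt_of_le_of_lt ?_ (half_lt_self hε)⟩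
  rw [dist_eq_norm, ← MemLp.toLp_sub]
  have hb : ∀ᵐ x ∂unitMeasure, ‖(hf.sub hg).toLp (f - g) x‖ ≤ ε / 2 := by
    filter_upwards [ae_mem_unit, (hf.sub hg).coeFn_toLp] with x hx hx'
    rw [hx']
    exact hfg x hx
  simpa [measureUnivNNReal] using Lp.norm_le_of_ae_bound (half_pos hε).le hb

end ClassMem

/-- The function `x^r (log x)^k`. -/
noncomputable def powLog (r : ℝ) (k : ℕ) (x : ℝ) : ℂ := ((x ^ r * Real.log x ^ k : ℝ) : ℂ)

theorem powLog_zero {r : ℝ} (hr : 0 < r) (k : ℕ) : powLog r k 0 = 0 := by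
  simp [powLog, Real.zero_rpow hr.ne']

theorem rpow_mul_abs_log_pow_le {r : ℝ} (hr : 0 < r) (k : ℕ) {x : ℝ} (hx0 : 0 < x) (hx1 : x ≤ 1) :
    x ^ r * |Real.log x| ^ k ≤ k.factorial / r ^ k := by
  have hL := Real.log_nonpos hx0.le hx1
  have h := Real.pow_div_factorial_le_exp (r * |Real.log x|) (by positivity) k
  have hx : x ^ r * Real.exp (r * |Real.log x|) = 1 := by
    rw [abs_of_nonpos hL, Real.rpow_def_of_pos hx0, ← Real.exp_add]
    ring_nf
    simp
  rw [le_div_iff₀ (by positivity)]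
  calc x ^ r * |Real.log x| ^ k * r ^ k
      = x ^ r * ((r * |Real.log x|) ^ k / k.factorial) * k.factorial := by
        rw [mul_pow]; field_simp
    _ ≤ x ^ r * Real.exp (r * |Real.log x|) * k.factorial := by
        have := Real.rpow_nonneg hx0.le r
        gcongr
    _ = k.factorial := by rw [hx, one_mul]

theorem memLp_powLog (p : ℝ≥0∞) {r : ℝ} (hr : 0 < r) (k : ℕ) :
    MemLp (powLog r k) p unitMeasure := by
  refine MemLp.of_bound ?_ (k.factorial / r ^ k) (ae_mem_unit.mono fun x hx => ?_)
  · unfold powLog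
    exact (by fun_prop : Measurable _).aestronglyMeasurable
  · rcases hx.1.eq_or_lt with rfl | hx0
    · rw [powLog_zero hr, norm_zero]; positivity
    · rw [powLog, Complex.norm_real, norm_mul, norm_pow, Real.norm_eq_abs (Real.log x),
        Real.norm_of_nonneg (Real.rpow_nonneg hx.1 r)]
      exact rpow_mul_abs_log_pow_le hr k hx0 hx.2

/-- The geometric factor comes from comparing `|z|^j` with `(2 |z|)^j` for `j ≥ N`. -/
theorem abs_exp_sub_sum_le (z : ℝ) (N : ℕ) :
    |Real.exp z - ∑ j ∈ Finset.range N, z ^ j / j.factorial|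
      ≤ (1 / 2) ^ N * Real.exp (2 * |z|) := by
  refine ((hasSum_pow_div_factorial z).sub (hasSum_ite_mem_range N _)).norm_le_of_bounded
    ((hasSum_pow_div_factorial (2 * |z|)).mul_left ((1 / 2) ^ N)) fun j => ?_
  split_ifs with hj
  · rw [sub_self, norm_zero]; positivity
  · have hNj : N ≤ j := not_lt.mp fun h => hj (Finset.mem_range.mpr h)
    rw [sub_zero, norm_div, norm_pow, Real.norm_eq_abs, Real.norm_natCast, mul_pow]
    have h2 : (1 : ℝ) ≤ (1 / 2) ^ N * 2 ^ j := by
      rw [one_div, inv_pow, ← div_eq_inv_mul, one_le_div (by positivity)]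
      exact pow_le_pow_right₀ (by norm_num) hNj
    calc |z| ^ j / j.factorial = 1 * (|z| ^ j / j.factorial) := (one_mul _).symm
      _ ≤ ((1 / 2) ^ N * 2 ^ j) * (|z| ^ j / j.factorial) := by gcongr
      _ = _ := by ring

section Closed
variable {p : ℝ≥0∞} [hp : Fact (1 ≤ p)] {K : Submodule ℂ (LpUnit p)}

/-- `x^(r+d) (log x)^k = ∑ⱼ (d^j / j!) x^r (log x)^(k+j)`, where the series converges uniformly on
`[0,1]` because `e^{2 |d log x|} ≤ x^(-r/2)` still leaves a decaying factor `x^(r/2)`. -/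
theorem classMem_powLog_add (hK : IsClosed (K : Set (LpUnit p))) {r d : ℝ} (hr : 0 < r)
    (hd : |d| ≤ r / 4) (h : ∀ k, ClassMem K (powLog r k)) (k : ℕ) :
    ClassMem K (powLog (r + d) k) := by
  have hrd : 0 < r + d := by linarith [neg_abs_le d]
  refine ClassMem.of_uniform_approx hK (memLp_powLog p hrd k) fun ε hε => ?_
  have hC : 0 < (k.factorial : ℝ) / (r / 2) ^ k := by positivity
  obtain ⟨N, hN⟩ := exists_pow_lt_of_lt_one (div_pos hε hC) (by norm_num : (1 / 2 : ℝ) < 1)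
  refine ⟨fun x => ∑ j ∈ Finset.range N, ((d ^ j / j.factorial : ℝ) : ℂ) * powLog r (k + j) x,
    ClassMem.sum _ fun j _ => (h (k + j)).const_mul _, fun x hx => ?_⟩
  rcases hx.1.eq_or_lt with rfl | hx0
  · simpa [powLog_zero hrd, powLog_zero hr] using hε.le
  · set L := Real.log x with hL
    have hL0 : L ≤ 0 := Real.log_nonpos hx.1 hx.2
    have e : powLog (r + d) k x
        - ∑ j ∈ Finset.range N, ((d ^ j / j.factorial : ℝ) : ℂ) * powLog r (k + j) x
        = ((x ^ r * L ^ k * (Real.exp (d * L)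
            - ∑ j ∈ Finset.range N, (d * L) ^ j / j.factorial) : ℝ) : ℂ) := by
      simp only [powLog, ← Complex.ofReal_mul, ← Complex.ofReal_sum, ← Complex.ofReal_sub, ← hL]
      congr 1
      rw [mul_sub, Finset.mul_sum, Real.rpow_add hx0, Real.rpow_def_of_pos hx0 d, ← hL]
      congr 1
      · rw [mul_comm L d]; ring
      · refine Finset.sum_congr rfl fun j _ => ?_
        rw [pow_add, mul_pow]; ring
    rw [e, Complex.norm_real, norm_mul, norm_mul, norm_pow, Real.norm_eq_abs L,
      Real.norm_of_nonneg (Real.rpow_nonneg hx.1 r), Real.norm_eq_abs]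
    have hexp : Real.exp (2 * |d * L|) ≤ Real.exp (-(r / 2 * L)) := by
      refine Real.exp_le_exp.mpr ?_
      rw [abs_mul, abs_of_nonpos hL0]
      nlinarith
    have hx2 : x ^ r * Real.exp (-(r / 2 * L)) = x ^ (r / 2) := by
      rw [Real.rpow_def_of_pos hx0, Real.rpow_def_of_pos hx0, ← Real.exp_add, ← hL]
      ring_nf
    have hxr := Real.rpow_nonneg hx.1 r
    calc x ^ r * |L| ^ k * |Real.exp (d * L) - ∑ j ∈ Finset.range N, (d * L) ^ j / j.factorial|
        ≤ x ^ r * |L| ^ k * ((1 / 2) ^ N * Real.exp (-(r / 2 * L))) := by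
          refine mul_le_mul_of_nonneg_left ((abs_exp_sub_sum_le _ N).trans ?_) (by positivity)
          gcongr
      _ = (1 / 2) ^ N * ((x ^ r * Real.exp (-(r / 2 * L))) * |L| ^ k) := by ring
      _ ≤ (1 / 2) ^ N * (k.factorial / (r / 2) ^ k) := by
          rw [hx2]
          gcongr
          exact rpow_mul_abs_log_pow_le (half_pos hr) k hx0 hx.2
      _ ≤ ε := ((lt_div_iff₀ hC).mp hN).le

theorem classMem_powLog_of_pos (hK : IsClosed (K : Set (LpUnit p))) {s : ℝ} (hs : 0 < s)
    (h : ∀ k, ClassMem K (powLog s k)) {r : ℝ} (hr : 0 < r) (k : ℕ) :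
    ClassMem K (powLog r k) := by
  have hm : 0 < min s r := lt_min hs hr
  obtain ⟨N, hN⟩ := exists_nat_gt (|r - s| / (min s r / 4))
  have hN0 : (0 : ℝ) < N := lt_of_le_of_lt (by positivity) hN
  -- Walk from `s` to `r` in `N` equal steps, each at most a quarter of the smaller endpoint.
  set d := (r - s) / N with hd
  have hdN : |d| ≤ min s r / 4 := by
    rw [hd, abs_div, abs_of_pos hN0, div_le_iff₀ hN0]
    rw [div_lt_iff₀ (by positivity)] at hN
    linarith
  have hlow : ∀ n : ℕ, n ≤ N → min s r ≤ s + n * d := by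
    intro n hn
    have hnN : (n : ℝ) / N ≤ 1 := (div_le_one hN0).mpr (by exact_mod_cast hn)
    have hnN0 : (0 : ℝ) ≤ (n : ℝ) / N := by positivity
    have e : s + n * d = (1 - n / N) * s + n / N * r := by rw [hd]; field_simp; ring
    rw [e]
    calc min s r = (1 - n / N) * min s r + n / N * min s r := by ring
      _ ≤ _ := add_le_add
          (mul_le_mul_of_nonneg_left (min_le_left _ _) (sub_nonneg.mpr hnN))
          (mul_le_mul_of_nonneg_left (min_le_right _ _) hnN0)
  have key : ∀ n : ℕ, n ≤ N → ∀ k, ClassMem K (powLog (s + n * d) k) := by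
    intro n
    induction n with
    | zero => simpa using h
    | succ n ih =>
      intro hn k
      have hl := hlow n (Nat.le_of_succ_le hn)
      have := classMem_powLog_add hK (hm.trans_le hl) (d := d) (by linarith)
        (ih (Nat.le_of_succ_le hn)) k
      convert this using 2
      push_cast
      ring
  have := key N le_rfl k
  rwa [hd, mul_div_cancel₀ _ hN0.ne', add_sub_cancel] at this

/-- The constant is the `L^p` limit of `x^(1/(n+1))`; the convergence is not uniform near `0`. -/
theorem classMem_one (hp' : p ≠ ∞) (hK : IsClosed (K : Set (LpUnit p)))
    (h : ∀ r, 0 < r → ClassMem K (powLog r 0)) : ClassMem K fun _ => (1 : ℂ) := by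
  have hpos : ∀ n : ℕ, (0 : ℝ) < 1 / ((n : ℝ) + 1) := fun n => by positivity
  refine ⟨memLp_const 1, ?_⟩
  have hbound : ∀ (n : ℕ), ∀ x ∈ Set.Icc (0 : ℝ) 1, ‖powLog (1 / ((n : ℝ) + 1)) 0 x‖ ≤ 1 := by
    intro n x hx
    rw [powLog, pow_zero, mul_one, Complex.norm_real, Real.norm_of_nonneg
      (Real.rpow_nonneg hx.1 _)]
    exact Real.rpow_le_one hx.1 hx.2 (hpos n).le
  have hui : UnifIntegrable (fun n : ℕ => powLog (1 / ((n : ℝ) + 1)) 0) p unitMeasure := by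
    refine unifIntegrable_of hp.out hp' (fun n => (memLp_powLog p (hpos n) 0).1) fun ε _ => ?_
    -- All functions are bounded by `1`, so the part exceeding `2` is empty.
    refine ⟨2, fun n => ?_⟩
    refine le_of_eq_of_le ?_ zero_le
    refine (eLpNorm_congr_ae (g := fun _ => (0 : ℂ)) ?_).trans eLpNorm_zero'
    filter_upwards [ae_mem_unit] with x hx
    refine Set.indicator_of_notMem (fun hmem => ?_) _
    have h2 : (2 : ℝ) ≤ ‖powLog (1 / ((n : ℝ) + 1)) 0 x‖ := by exact_mod_cast hmem
    linarith [hbound n x hx]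
  have hlim := tendsto_Lp_finite_of_tendsto_ae hp.out hp'
    (fun n => (memLp_powLog p (hpos n) 0).1) (memLp_const (1 : ℂ)) hui (by
      have h0 : ∀ᵐ x ∂unitMeasure, x ≠ 0 := ae_restrict_of_ae (by simp [ae_iff])
      filter_upwards [h0] with x hx0
      have := (Real.continuousAt_const_rpow hx0 (b := 0)).tendsto.comp
        tendsto_one_div_add_atTop_nhds_zero_nat
      rw [Real.rpow_zero] at this
      have h2 := (Complex.continuous_ofReal.tendsto _).comp this
      simpa [powLog, Function.comp_def] using h2)
  rw [← Lp.tendsto_Lp_iff_tendsto_eLpNorm'' _ (fun n => memLp_powLog p (hpos n) 0) _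
    (memLp_const 1)] at hlim
  exact hK.mem_of_tendsto hlim (Filter.Eventually.of_forall fun n => (h _ (hpos n)).2)

theorem classMem_polynomial (hp' : p ≠ ∞) (hK : IsClosed (K : Set (LpUnit p)))
    (h : ∀ r, 0 < r → ClassMem K (powLog r 0)) (P : Polynomial ℝ) :
    ClassMem K fun x => ((P.eval x : ℝ) : ℂ) := by
  have hmon : ∀ m : ℕ, ClassMem K fun x => ((x ^ m : ℝ) : ℂ) := by
    intro m
    rcases Nat.eq_zero_or_pos m with rfl | hm
    · simpa using classMem_one hp' hK h
    · exact (h m (by exact_mod_cast hm)).congr fun x _ => by simp [powLog]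
  refine (ClassMem.sum (Finset.range (P.natDegree + 1)) fun m _ =>
    (hmon m).const_mul ((P.coeff m : ℝ) : ℂ)).congr fun x _ => ?_
  rw [Polynomial.eval_eq_sum_range]
  push_cast
  rfl

/-- The powers of `x` with positive exponent give all polynomials, hence by Weierstrass all
continuous functions, which are dense. -/
theorem eq_top_of_classMem_powLog (hp' : p ≠ ∞) (hK : IsClosed (K : Set (LpUnit p)))
    (h : ∀ r, 0 < r → ClassMem K (powLog r 0)) : K = ⊤ := by
  have hpoly := classMem_polynomial hp' hK h
  have hreal : ∀ u : ℝ → ℝ, Continuous u → ClassMem K fun x => ((u x : ℝ) : ℂ) := by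
    intro u hu
    have hmem : MemLp (fun x => ((u x : ℝ) : ℂ)) p unitMeasure := by
      obtain ⟨C, hC⟩ := isCompact_Icc.exists_bound_of_continuousOn
        (Complex.continuous_ofReal.comp hu).continuousOn (s := Set.Icc (0 : ℝ) 1)
      exact MemLp.of_bound (Complex.continuous_ofReal.comp hu).aestronglyMeasurable C
        (ae_mem_unit.mono hC)
    refine ClassMem.of_uniform_approx hK hmem fun ε hε => ?_
    obtain ⟨P, hP⟩ := exists_polynomial_near_of_continuousOn 0 1 u hu.continuousOn ε hε
    refine ⟨_, hpoly P, fun x hx => ?_⟩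
    rw [← Complex.ofReal_sub, Complex.norm_real, Real.norm_eq_abs, abs_sub_comm]
    exact (hP x hx).le
  have hd := BoundedContinuousFunction.toLp_denseRange (p := p) ℂ unitMeasure ℂ hp'
  have hsub : Set.range (BoundedContinuousFunction.toLp p unitMeasure ℂ :
      BoundedContinuousFunction ℝ ℂ →L[ℂ] LpUnit p) ⊆ (K : Set (LpUnit p)) := by
    rintro _ ⟨g, rfl⟩
    obtain ⟨hg, hgK⟩ := ((hreal (fun x => (g x).re) (by fun_prop)).add
      ((hreal (fun x => (g x).im) (by fun_prop)).const_mul Complex.I)).congr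
      (g := g) fun x _ => by
        rw [Pi.add_apply, mul_comm Complex.I, Complex.re_add_im]
    have : BoundedContinuousFunction.toLp p unitMeasure ℂ g = hg.toLp g :=
      Lp.ext ((BoundedContinuousFunction.coeFn_toLp p unitMeasure ℂ g).trans hg.coeFn_toLp.symm)
    rw [this]
    exact hgK
  have := (hd.mono hsub).closure_eq
  rw [hK.closure_eq] at this
  exact SetLike.coe_injective this

end Closed

/-- Since `eigenPoly α n` has degree exactly `n`, these polynomials span all polynomials. -/
theorem classMem_powLog_of_eigenFun {p : ℝ≥0∞} {K : Submodule ℂ (LpUnit p)} {α : ℝ} (hα : 0 < α)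
    (h1 : α < 1) (h : ∀ n, ClassMem K (eigenFun α n)) (k : ℕ) :
    ClassMem K (powLog (α / (1 - α)) k) := by
  let S : Polynomial.Sequence ℝ := ⟨eigenPoly α, degree_eigenPoly hα h1⟩
  have hspan : Submodule.span ℝ (Set.range S) = ⊤ := S.span fun i =>
    (Polynomial.leadingCoeff_ne_zero.mpr (S.ne_zero i)).isUnit
  have key : ∀ P : Polynomial ℝ,
      ClassMem K fun x => ((x ^ (α / (1 - α)) * P.eval (Real.log x) : ℝ) : ℂ) := by
    intro P
    have hP : P ∈ Submodule.span ℝ (Set.range S) := by rw [hspan]; trivial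
    induction hP using Submodule.span_induction with
    | mem P hP =>
      obtain ⟨n, rfl⟩ := hP
      exact h n
    | zero => simpa using ClassMem.zero
    | add P Q _ _ hP hQ =>
      refine (hP.add hQ).congr fun x _ => ?_
      simp only [Pi.add_apply, Polynomial.eval_add]
      push_cast
      ring
    | smul c P _ hP =>
      refine (hP.const_mul (c : ℂ)).congr fun x _ => ?_
      simp only [Polynomial.eval_smul, smul_eq_mul]
      push_cast
      ring
  exact (key (Polynomial.X ^ k)).congr fun x _ => by simp [powLog]

end

end VolterraType

theorem theorem3 (p : ENNReal) [Fact (1 ≤ p)] (hp1 : 1 < p) (hp : p ≠ ⊤)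
    (α : ℝ) (hα : 0 < α) :
    (1 ≤ α →
      spectrum ℂ (VolterraType.volterraOp p hα) = {0} ∧
      VolterraType.pointSpectrum (VolterraType.volterraOp p hα) = ∅) ∧
    (α < 1 →
      spectrum ℂ (VolterraType.volterraOp p hα)
        = VolterraType.pointSpectrum (VolterraType.volterraOp p hα) ∪ {0} ∧
      VolterraType.pointSpectrum (VolterraType.volterraOp p hα)
        = Set.range (fun n : ℕ => ((α ^ n * (1 - α) : ℝ) : ℂ)) ∧
      (∀ n : ℕ, (VolterraType.eigenPoly α n).degree = n) ∧
      ∃ hmem : ∀ n : ℕ,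
          MeasureTheory.MemLp (VolterraType.eigenFun α n) p VolterraType.unitMeasure,
        (∀ n : ℕ,
          Module.End.eigenspace
              (VolterraType.volterraOp p hα :
                VolterraType.LpUnit p →ₗ[ℂ] VolterraType.LpUnit p)
              ((α ^ n * (1 - α) : ℝ) : ℂ)
            = Submodule.span ℂ {(hmem n).toLp (VolterraType.eigenFun α n)}) ∧
        Dense ((Submodule.span ℂ
            (Set.range fun n : ℕ => (hmem n).toLp (VolterraType.eigenFun α n)) :
              Submodule ℂ (VolterraType.LpUnit p)) : Set (VolterraType.LpUnit p))) := by
  have hsub : VolterraType.pointSpectrum (VolterraType.volterraOp p hα)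
      ⊆ spectrum ℂ (VolterraType.volterraOp p hα) := fun l hl =>
    VolterraType.pointSpectrum_subset_spectrum _ hl
  refine ⟨fun h1 => ?_, fun h1 => ?_⟩
  · have hle : spectrum ℂ (VolterraType.volterraOp p hα) ⊆ {0} := fun l hl =>
      VolterraType.eq_zero_of_mem_spectrum_of_norm_pow_le
        (VolterraType.norm_volterraOp_pow_succ_le p hα h1) hl
    refine ⟨(Set.Nonempty.subset_singleton_iff (spectrum.nonempty _)).mp hle, ?_⟩
    refine Set.eq_empty_of_forall_notMem fun l hl => ?_
    obtain rfl : l = 0 := hle (hsub hl)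
    exact VolterraType.zero_notMem_pointSpectrum p hα hl
  · have h1' : 0 < 1 - α := sub_pos.mpr h1
    have hpt := VolterraType.pointSpectrum_volterraOp_eq p hα h1
    have hαc : (α : ℂ) ≠ 0 := by exact_mod_cast hα.ne'
    have hμ : ∀ n : ℕ, ((α : ℂ) ^ n)⁻¹ * (α : ℂ) ^ n = 1 := fun n =>
      inv_mul_cancel₀ (pow_ne_zero n hαc)
    have hfun : ∀ n : ℕ, VolterraType.eigenFun α n
        = VolterraType.pantographSol α ((α : ℂ) ^ n)⁻¹ := fun n =>
      funext (VolterraType.eigenFun_eq_pantographSol hα h1 (hμ n))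
    have hmem : ∀ n : ℕ,
        MeasureTheory.MemLp (VolterraType.eigenFun α n) p VolterraType.unitMeasure := fun n => by
      rw [hfun n]
      exact VolterraType.memLp_pantographSol p hα h1 _
    refine ⟨?_, hpt, VolterraType.degree_eigenPoly hα h1, hmem, fun n => ?_, ?_⟩
    · refine Set.Subset.antisymm (fun l hl => ?_) (Set.union_subset hsub ?_)
      · by_cases hl0 : l = 0
        · exact Or.inr hl0
        · exact Or.inl (VolterraType.mem_pointSpectrum_of_mem_spectrum p hα h1.le hl0 hl)
      · -- The spectrum is closed and contains the eigenvalues `α ^ n * (1 - α) → 0`.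
        have hlim : Filter.Tendsto (fun n : ℕ => ((α ^ n * (1 - α) : ℝ) : ℂ)) Filter.atTop
            (nhds 0) := by
          have := (tendsto_pow_atTop_nhds_zero_of_lt_one hα.le h1).mul_const (1 - α)
          rw [zero_mul] at this
          exact_mod_cast (Complex.continuous_ofReal.tendsto _).comp this
        refine Set.singleton_subset_iff.mpr ((spectrum.isClosed _).mem_of_tendsto hlim
          (Filter.Eventually.of_forall fun n => hsub ?_))
        rw [hpt]
        exact ⟨n, rfl⟩
    · have hl0 : ((α ^ n * (1 - α) : ℝ) : ℂ) ≠ 0 := by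
        exact_mod_cast (mul_pos (pow_pos hα n) h1').ne'
      have hl : ((α ^ n * (1 - α) : ℝ) : ℂ) * ((α : ℂ) ^ n)⁻¹ = ((1 - α : ℝ) : ℂ) := by
        push_cast
        field_simp
      rw [VolterraType.eigenspace_volterraOp_eq_span p hα h1 hl0 hl ⟨n, hμ n⟩]
      congr 2
      exact MeasureTheory.MemLp.toLp_congr _ _ (by rw [hfun n])
    · rw [Submodule.dense_iff_topologicalClosure_eq_top]
      refine VolterraType.eq_top_of_classMem_powLog hp (Submodule.isClosed_topologicalClosure _)
        fun r hr => ?_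
      refine VolterraType.classMem_powLog_of_pos (Submodule.isClosed_topologicalClosure _)
        (div_pos hα h1') (VolterraType.classMem_powLog_of_eigenFun hα h1 fun n => ⟨hmem n, ?_⟩) hr 0
      exact Submodule.le_topologicalClosure _ (Submodule.subset_span ⟨n, rfl⟩)
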